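/- Let $C[0,1]$ be the real vector space of all continuous functions $f\colon[0,1]\to\mathbb R$ with the topology of uniform convergence (supremum norm), and let $BVC[0,1]\subset C[0,1]$ be the set of those $f$ whose total variation $\operatorname{Var}(f)=\sup\sum_{i}|f(x_{i+1})-f(x_i)|$, the supremum over all partitions $0=x_0<x_1<\dots<x_n=1$, is finite. Let $\aleph_0=\operatorname{card}(\mathbb N)$ and $\mathfrak c=\operatorname{card}(\mathbb R)$. For cardinals $\alpha,\beta$, a subset $A$ of a topological vector space $E$ is called $(\alpha,\beta)$-spaceable in $E$ if (i) there is a vector subspace $F\subset E$ with $\dim F=\alpha$ and $F\setminus\{0\}\subset A$, and (ii) for every vector subspace $F\subset E$ with $\dim F=\alpha$ and $F\subset A\cup\{0\}$ there is a closed vector subspace $G\subset E$ with $\dim G=\beta$ and $F\subset G\subset A\cup\{0\}$. Here $\dim$ is the algebraic (Hamel) dimension. Then, for every cardinal number $\alpha$, the set $C[0,1]\setminus BVC[0,1]$ is $(\alpha,\mathfrak c)$-spaceable in $C[0,1]$ if and only if $\alpha<\aleph_0$. -/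

import Mathlib

universe u v

/-- A subset `A` of a `K`-vector space `E` is `β`-lineable if there is a vector subspace of `E`
of dimension `β` all of whose nonzero vectors lie in `A`. -/
def IsLineable (K : Type v) {E : Type u} [Field K] [AddCommGroup E] [Module K E]
    (β : Cardinal.{u}) (A : Set E) : Prop :=
  ∃ F : Submodule K E, Module.rank K F = β ∧ (F : Set E) \ {0} ⊆ A

/-- A subset `A` of a topological `K`-vector space `E` is `(α, β)`-spaceable if it is `α`-lineable
and every `α`-dimensional subspace `F ⊆ A ∪ {0}` is contained in a closed `β`-dimensional
subspace `G ⊆ A ∪ {0}`. The notion is usually considered only for `α < β ≤ dim E`; if `β < α` or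
`dim E < β`, then no set satisfies this definition. -/
def IsSpaceable (K : Type v) {E : Type u} [Field K] [AddCommGroup E] [Module K E]
    [TopologicalSpace E] (α β : Cardinal.{u}) (A : Set E) : Prop :=
  IsLineable K α A ∧
    ∀ F : Submodule K E, Module.rank K F = α → (F : Set E) ⊆ A ∪ {0} →
      ∃ G : Submodule K E, Module.rank K G = β ∧ IsClosed (G : Set E) ∧
        F ≤ G ∧ (G : Set E) ⊆ A ∪ {0}

/-- The set of all continuous functions `[0,1] → ℝ` of bounded variation, inside the space
`C[0,1]` of all continuous real functions on `[0,1]`. -/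
def BVC : Set C(unitInterval, ℝ) :=
  {f | BoundedVariationOn f Set.univ}

open Set Filter Topology unitInterval

/-! Finite `α`: by compactness of `[0,1]`, a function of unbounded variation has unbounded variation
near some point. If `F` is finite-dimensional and meets `BVC` trivially, finitely many points detect
this for all of `F`. In an interval `[a, b]` missing these points, place disjoint chirps of
unbounded variation. The functions proportional to one chirp on each block form a closed space `W`
that meets `BVC` trivially and contains continuum many independent series. `W ⊔ F` is closed since
`F` is finite-dimensional. If `w + f` has bounded variation, so does `f` off `[a, b]`, where `w`
vanishes; hence `f = 0`, and then `w = 0`.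

Infinite `α`: rescale independent functions so that a sequence of them tends to `0`, then add `1` to
each. Their span still meets `BVC` trivially, but every closed space containing it contains `1`. -/

/-! ### Bounded variation and its localization -/

theorem BoundedVariationOn.add {α E : Type*} [LinearOrder α] [SeminormedAddCommGroup E]
    {f g : α → E} {s : Set α} (hf : BoundedVariationOn f s) (hg : BoundedVariationOn g s) :
    BoundedVariationOn (f + g) s := by
  refine ne_top_of_le_ne_top (ENNReal.add_ne_top.2 ⟨hf, hg⟩) (iSup_le ?_)
  rintro ⟨n, u, hu, us⟩
  calc ∑ i ∈ Finset.range n, edist ((f + g) (u (i + 1))) ((f + g) (u i))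
      ≤ ∑ i ∈ Finset.range n, (edist (f (u (i + 1))) (f (u i)) + edist (g (u (i + 1))) (g (u i))) :=
        Finset.sum_le_sum fun i _ => edist_add_add_le _ _ _ _
    _ ≤ _ := by
        rw [Finset.sum_add_distrib]
        exact add_le_add (eVariationOn.sum_le hu us) (eVariationOn.sum_le hu us)

theorem BoundedVariationOn.of_const {α E : Type*} [LinearOrder α] [PseudoEMetricSpace E]
    (c : E) (s : Set α) : BoundedVariationOn (fun _ : α => c) s := by
  rw [BoundedVariationOn, eVariationOn.constant_on]
  · exact ENNReal.zero_ne_top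
  · exact (subsingleton_singleton (a := c)).anti (by rintro _ ⟨x, _, rfl⟩; rfl)

theorem BoundedVariationOn.const_mul {α : Type*} [LinearOrder α] {f : α → ℝ} {s : Set α}
    (hf : BoundedVariationOn f s) (c : ℝ) : BoundedVariationOn (fun x => c * f x) s :=
  (BoundedVariationOn.of_const c s).mul hf

theorem BoundedVariationOn.congr {α E : Type*} [LinearOrder α] [PseudoEMetricSpace E]
    {f g : α → E} {s : Set α} (hf : BoundedVariationOn f s) (h : EqOn f g s) :
    BoundedVariationOn g s := by
  rw [BoundedVariationOn, ← eVariationOn.eq_of_eqOn h]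
  exact hf

/-- The continuous functions on `[0,1]` of bounded variation on some neighbourhood of `x`. -/
def locallyBoundedVariationAt (x : I) : Submodule ℝ C(I, ℝ) where
  carrier := {f | ∃ U, IsOpen U ∧ x ∈ U ∧ BoundedVariationOn f U}
  add_mem' := by
    rintro f g ⟨U, hU, hxU, hf⟩ ⟨V, hV, hxV, hg⟩
    exact ⟨U ∩ V, hU.inter hV, ⟨hxU, hxV⟩,
      (hf.mono inter_subset_left).add (hg.mono inter_subset_right)⟩
  zero_mem' := ⟨univ, isOpen_univ, mem_univ x, BoundedVariationOn.of_const 0 univ⟩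
  smul_mem' := by
    rintro c f ⟨U, hU, hxU, hf⟩
    exact ⟨U, hU, hxU, hf.const_mul c⟩

theorem mem_BVC_of_forall_locallyBoundedVariationAt {f : C(I, ℝ)}
    (hf : ∀ x, f ∈ locallyBoundedVariationAt x) : f ∈ BVC := by
  choose U hU hxU hfU using hf
  obtain ⟨t, ht0, htm, ⟨n, hn⟩, ht⟩ := exists_monotone_Icc_subset_open_cover_unitInterval hU
    fun x _ => mem_iUnion.2 ⟨x, hxU x⟩
  have huniv : (univ : Set I) = Icc (t 0) (t n) := by
    rw [ht0, hn n le_rfl]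
    exact (eq_univ_of_forall fun x : I => mem_Icc.2 ⟨x.2.1, x.2.2⟩).symm
  change BoundedVariationOn f univ
  rw [huniv, BoundedVariationOn, ← eVariationOn.sum' _ htm]
  refine ENNReal.sum_ne_top.2 fun i _ => ?_
  obtain ⟨x, hx⟩ := ht i
  exact (hfU x).mono hx

theorem add_mem_BVC {f g : C(I, ℝ)} (hf : f ∈ BVC) (hg : g ∈ BVC) : f + g ∈ BVC :=
  BoundedVariationOn.add hf hg

theorem const_smul_one_mem_BVC (c : ℝ) : c • (1 : C(I, ℝ)) ∈ BVC :=
  BoundedVariationOn.of_const (c * 1) univ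

/-- A finite-dimensional space without nonzero functions of bounded variation has no nonzero
function which is of bounded variation near each point of a suitable finite set. -/
theorem exists_finset_forall_locallyBoundedVariationAt_imp_eq_zero (F : Submodule ℝ C(I, ℝ))
    [FiniteDimensional ℝ F] (hF : ∀ f ∈ F, f ∈ BVC → f = 0) :
    ∃ s : Finset I, ∀ f ∈ F, (∀ x ∈ s, f ∈ locallyBoundedVariationAt x) → f = 0 := by
  classical
  let P : Finset I → Submodule ℝ F :=
    fun s => (⨅ x ∈ s, locallyBoundedVariationAt x).comap F.subtype
  -- Take `P s` minimal: one more point `x` cannot shrink it, so its members have bounded variation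
  -- near every `x`.
  obtain ⟨_, ⟨s, rfl⟩, hs⟩ := IsArtinian.set_has_minimal (range P) ⟨_, ∅, rfl⟩
  refine ⟨s, fun f hfF hf => hF f hfF (mem_BVC_of_forall_locallyBoundedVariationAt fun x => ?_)⟩
  have hle : P (insert x s) ≤ P s := Submodule.comap_mono
    (biInf_mono fun y hy => Finset.mem_insert_of_mem hy)
  have heq : P (insert x s) = P s := hle.eq_of_not_lt (hs _ ⟨_, rfl⟩)
  have hmem : (⟨f, hfF⟩ : F) ∈ P s := by simpa [P] using hf
  rw [← heq] at hmem
  simp only [P, Submodule.mem_comap, Submodule.mem_iInf] at hmem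
  exact hmem x (Finset.mem_insert_self x s)

/-! ### Chirps of unbounded variation -/

/-- A continuous function oscillating near `a` and vanishing outside `(a, b)`. -/
noncomputable def chirp (a b x : ℝ) : ℝ :=
  max 0 ((x - a) * (b - x)) * Real.cos (Real.pi * (b - a) / (x - a))

theorem chirp_eq_zero {a b x : ℝ} (hab : a < b) (hx : x ∉ Ioo a b) :
    chirp a b x = 0 := by
  have : (x - a) * (b - x) ≤ 0 := by
    rcases le_or_gt x a with h | h
    · nlinarith
    · have : b ≤ x := le_of_not_gt fun h' => hx ⟨h, h'⟩
      nlinarith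
  rw [chirp, max_eq_left this, zero_mul]

theorem continuous_chirp (a b : ℝ) : Continuous (chirp a b) := by
  rw [continuous_iff_continuousAt]
  intro x
  rcases eq_or_ne x a with rfl | hx
  · have h0 : Tendsto (fun y : ℝ => max 0 ((y - x) * (b - y))) (𝓝 x) (𝓝 0) := by
      have : Continuous fun y : ℝ => max 0 ((y - x) * (b - y)) := by fun_prop
      simpa using this.tendsto x
    have hx : chirp x b x = 0 := by simp [chirp]
    rw [ContinuousAt, hx]
    refine h0.zero_mul_isBoundedUnder_le (isBoundedUnder_of ⟨1, fun y => ?_⟩)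
    exact Real.abs_cos_le_one _
  · have : x - a ≠ 0 := sub_ne_zero.2 hx
    unfold chirp
    fun_prop (disch := assumption)

/-- At these points the phase is `(k + 2)π`, so signs alternate. The shift by `2` keeps the point
for `k = 0` away from `b`. -/
theorem chirp_apply {a b : ℝ} (hab : a < b) (k : ℕ) :
    chirp a b (a + (b - a) / (k + 2)) =
      (b - a) ^ 2 * (k + 1) / (k + 2) ^ 2 * (-1) ^ k := by
  have hk : (0 : ℝ) < k + 2 := by positivity
  have hba : b - a ≠ 0 := (sub_pos.2 hab).ne'
  have h1 : (a + (b - a) / (k + 2) - a) * (b - (a + (b - a) / (k + 2))) =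
      (b - a) ^ 2 * (k + 1) / (k + 2) ^ 2 := by
    field_simp
    ring
  have h2 : Real.pi * (b - a) / (a + (b - a) / (k + 2) - a) = k * Real.pi + 2 * Real.pi := by
    rw [add_sub_cancel_left]
    field_simp
  rw [chirp, h1, h2, Real.cos_add_two_pi, Real.cos_nat_mul_pi, max_eq_right (by positivity)]

/-- The oscillating function, restricted to `[0,1]`. -/
noncomputable def chirpMap (a b : ℝ) : C(I, ℝ) :=
  ⟨fun x => chirp a b x, (continuous_chirp a b).comp continuous_subtype_val⟩

theorem not_boundedVariationOn_chirpMap {a b : I} (hab : a < b) :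
    ¬ BoundedVariationOn (chirpMap a b) (Ioo a b) := by
  intro h
  have hab' : (a : ℝ) < b := hab
  have hpos : 0 < (b : ℝ) - a := sub_pos.2 hab'
  have hmem (k : ℕ) : (a : ℝ) + (b - a) / (k + 2) ∈ Ioo (a : ℝ) b := by
    have hk : (0 : ℝ) < k + 2 := by positivity
    constructor
    · have := div_pos hpos hk
      linarith
    · have : ((b : ℝ) - a) / (k + 2) < b - a := div_lt_self hpos (by linarith [k.cast_nonneg (α := ℝ)])
      linarith
  let u : ℕ → I := fun k => ⟨a + (b - a) / (k + 2),
    a.2.1.trans (hmem k).1.le, (hmem k).2.le.trans b.2.2⟩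
  have hu : Antitone u := by
    intro i j hij
    rw [← Subtype.coe_le_coe]
    change (a : ℝ) + (b - a) / (j + 2) ≤ a + (b - a) / (i + 2)
    gcongr
  have hbdd : BoundedVariationOn (chirpMap a b ∘ u) univ :=
    ne_top_of_le_ne_top h
      (eVariationOn.comp_le_of_antitoneOn _ u (hu.antitoneOn _) fun k _ => hmem k)
  have hval (k : ℕ) : (chirpMap a b ∘ u) k =
      ((b : ℝ) - a) ^ 2 * (k + 1) / (k + 2) ^ 2 * (-1) ^ k := chirp_apply hab' k
  -- Alternating signs make the jump `A + B`; already `B` dominates a harmonic term, as `(k + 2)² ≤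
  -- 4(k + 1)²`.
  have hdist (k : ℕ) : ((b : ℝ) - a) ^ 2 / 4 * (1 / ((k : ℝ) + 1)) ≤
      dist ((chirpMap a b ∘ u) (k + 1)) ((chirpMap a b ∘ u) k) := by
    rw [hval, hval, Real.dist_eq, pow_succ (-1 : ℝ)]
    push_cast
    set A := ((b : ℝ) - a) ^ 2 * ((k : ℝ) + 1 + 1) / ((k : ℝ) + 1 + 2) ^ 2
    have hA : 0 ≤ A := by positivity
    have hB : ((b : ℝ) - a) ^ 2 / 4 * (1 / ((k : ℝ) + 1)) ≤
        ((b : ℝ) - a) ^ 2 * (k + 1) / (k + 2) ^ 2 := by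
      have : (1 : ℝ) / (4 * (k + 1)) ≤ (k + 1) / (k + 2) ^ 2 := by
        rw [div_le_div_iff₀ (by positivity) (by positivity)]
        nlinarith [k.cast_nonneg (α := ℝ)]
      calc ((b : ℝ) - a) ^ 2 / 4 * (1 / ((k : ℝ) + 1))
          = ((b : ℝ) - a) ^ 2 * (1 / (4 * (k + 1))) := by field_simp
        _ ≤ ((b : ℝ) - a) ^ 2 * ((k + 1) / (k + 2) ^ 2) := by gcongr
        _ = _ := by ring
    set B := ((b : ℝ) - a) ^ 2 * (k + 1) / (k + 2) ^ 2
    rw [show A * ((-1) ^ k * -1) - B * (-1) ^ k = -((A + B) * (-1) ^ k) by ring, abs_neg, abs_mul,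
      abs_pow, abs_neg, abs_one, one_pow, mul_one]
    exact (hB.trans (by linarith)).trans (le_abs_self _)
  have hsum (n : ℕ) : ∑ k ∈ Finset.range n, ((b : ℝ) - a) ^ 2 / 4 * (1 / ((k : ℝ) + 1)) ≤
      (eVariationOn (chirpMap a b ∘ u) univ).toReal := by
    refine (Finset.sum_le_sum fun k _ => hdist k).trans ?_
    have := ENNReal.toReal_mono hbdd (eVariationOn.sum_le (f := chirpMap a b ∘ u) (n := n)
      monotone_id fun i => mem_univ i)
    rw [ENNReal.toReal_sum fun i _ => edist_ne_top _ _] at this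
    simpa only [← dist_edist, id] using this
  have htop := Real.tendsto_sum_range_one_div_nat_succ_atTop.const_mul_atTop
    (show 0 < ((b : ℝ) - a) ^ 2 / 4 by positivity)
  obtain ⟨n, hn⟩ := (htop.eventually_gt_atTop
    (eVariationOn (chirpMap a b ∘ u) univ).toReal).exists
  rw [Finset.mul_sum] at hn
  exact hn.not_ge (hsum n)
-- The closed space spanned by disjoint blocks
/-- The continuous functions which are proportional to `g n` on each `J n`, and vanish outside the
union of the sets `J n`. -/
def blockSpace (g : ℕ → C(I, ℝ)) (J : ℕ → Set I) : Submodule ℝ C(I, ℝ) where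
  carrier := {h | (∀ n, ∀ x ∈ J n, ∀ y ∈ J n, h x * g n y = h y * g n x) ∧
    ∀ x, (∀ n, x ∉ J n) → h x = 0}
  add_mem' := by
    rintro f h ⟨hf, hf'⟩ ⟨hh, hh'⟩
    refine ⟨fun n x hx y hy => ?_, fun x hx => ?_⟩
    · rw [ContinuousMap.add_apply, ContinuousMap.add_apply, add_mul, add_mul, hf n x hx y hy,
        hh n x hx y hy]
    · rw [ContinuousMap.add_apply, hf' x hx, hh' x hx, add_zero]
  zero_mem' := ⟨fun n x _ y _ => by simp, fun x _ => rfl⟩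
  smul_mem' := by
    rintro c f ⟨hf, hf'⟩
    refine ⟨fun n x hx y hy => ?_, fun x hx => ?_⟩
    · rw [ContinuousMap.smul_apply, ContinuousMap.smul_apply, smul_eq_mul, smul_eq_mul, mul_assoc,
        mul_assoc, hf n x hx y hy]
    · rw [ContinuousMap.smul_apply, hf' x hx, smul_zero]

theorem isClosed_blockSpace (g : ℕ → C(I, ℝ)) (J : ℕ → Set I) :
    IsClosed (blockSpace g J : Set C(I, ℝ)) := by
  have : (blockSpace g J : Set C(I, ℝ)) =
      (⋂ n, ⋂ x ∈ J n, ⋂ y ∈ J n, {h : C(I, ℝ) | h x * g n y = h y * g n x}) ∩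
        ⋂ x, ⋂ (_ : ∀ n, x ∉ J n), {h : C(I, ℝ) | h x = 0} := by
    ext h
    simp only [mem_inter_iff, mem_iInter, mem_ofPred_eq]
    rfl
  rw [this]
  refine IsClosed.inter ?_ ?_
  · exact isClosed_iInter fun n => isClosed_iInter fun x => isClosed_iInter fun _ =>
      isClosed_iInter fun y => isClosed_iInter fun _ => isClosed_eq
        ((continuous_eval_const x).mul continuous_const)
        ((continuous_eval_const y).mul continuous_const)
  · exact isClosed_iInter fun x => isClosed_iInter fun _ =>
      isClosed_eq (continuous_eval_const x) continuous_const

theorem eq_zero_of_mem_blockSpace_of_mem_BVC {g : ℕ → C(I, ℝ)} {J : ℕ → Set I}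
    (hg : ∀ n, ¬ BoundedVariationOn (g n) (J n)) {h : C(I, ℝ)} (hh : h ∈ blockSpace g J)
    (hBV : h ∈ BVC) : h = 0 := by
  ext x
  by_contra hx
  replace hx : h x ≠ 0 := hx
  by_cases hJ : ∀ n, x ∉ J n
  · exact hx (hh.2 x hJ)
  · push Not at hJ
    obtain ⟨n, hn⟩ := hJ
    -- Since `h x ≠ 0`, on `J n` the function `g n` is a constant multiple of `h`.
    refine hg n ((BoundedVariationOn.const_mul (BoundedVariationOn.mono hBV (subset_univ (J n)))
      (g n x / h x)).congr fun y hy => ?_)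
    have := hh.1 n x hn y hy
    field_simp
    linarith

theorem mem_blockSpace {g : ℕ → C(I, ℝ)} {J : ℕ → Set I} (hJ : Pairwise (Function.onFun Disjoint J))
    (hg : ∀ n, ∀ x ∉ J n, g n x = 0) (n : ℕ) : g n ∈ blockSpace g J := by
  refine ⟨fun m x hx y hy => ?_, fun x hx => hg n x (hx n)⟩
  rcases eq_or_ne n m with rfl | hnm
  · exact mul_comm _ _
  · rw [hg n x ((hJ hnm).notMem_of_mem_right hx), hg n y ((hJ hnm).notMem_of_mem_right hy),
      zero_mul, zero_mul]

/-- Dedekind's independence of characters, for the monoid `ℕ`. -/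
theorem linearIndependent_pow_sequence :
    LinearIndependent ℝ fun (t : Ioo (0 : ℝ) 1) (n : ℕ) => (t : ℝ) ^ n := by
  have h := (linearIndependent_monoidHom (Multiplicative ℕ) ℝ).comp
    (fun t : Ioo (0 : ℝ) 1 => powersHom ℝ t)
    ((powersHom ℝ).injective.comp Subtype.val_injective)
  exact h

/-- The series `∑ tⁿ g n / ‖g n‖`, `0 < t < 1`, are independent: evaluation at points `p n` with `g
n (p n) ≠ 0` recovers the sequences `tⁿ`. -/
theorem continuum_le_rank_of_blockSpace_le {g : ℕ → C(I, ℝ)} {J : ℕ → Set I}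
    (hJ : Pairwise (Function.onFun Disjoint J)) (hg : ∀ n, ∀ x ∉ J n, g n x = 0)
    (hg0 : ∀ n, g n ≠ 0) {G : Submodule ℝ C(I, ℝ)} (hG : blockSpace g J ≤ G) :
    Cardinal.continuum ≤ Module.rank ℝ G := by
  have hp (n : ℕ) : ∃ p, g n p ≠ 0 := by
    by_contra! h
    exact hg0 n (ContinuousMap.ext h)
  choose p hp using hp
  have hpJ (n : ℕ) : p n ∈ J n := by
    by_contra h
    exact hp n (hg n _ h)
  have hzero {m n : ℕ} (hmn : m ≠ n) : g m (p n) = 0 :=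
    hg m _ ((hJ hmn).notMem_of_mem_right (hpJ n))
  have hnorm (n : ℕ) : 0 < ‖g n‖ := norm_pos_iff.2 (hg0 n)
  let φ : Ioo (0 : ℝ) 1 → ℕ → C(I, ℝ) := fun t n => ((t : ℝ) ^ n * ‖g n‖⁻¹) • g n
  have hsum (t : Ioo (0 : ℝ) 1) : Summable (φ t) := by
    refine Summable.of_norm_bounded (summable_geometric_of_lt_one t.2.1.le t.2.2) fun n => ?_
    rw [norm_smul, norm_mul, norm_inv, norm_norm, mul_assoc, inv_mul_cancel₀ (hnorm n).ne', mul_one,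
      Real.norm_of_nonneg (pow_nonneg t.2.1.le n)]
  let w : Ioo (0 : ℝ) 1 → G := fun t => ⟨∑' n, φ t n, hG (tsum_mem (isClosed_blockSpace g J)
    fun n => Submodule.smul_mem _ _ (mem_blockSpace hJ hg n))⟩
  let L : G →ₗ[ℝ] (ℕ → ℝ) := LinearMap.pi fun n =>
    (‖g n‖ * (g n (p n))⁻¹) • ((ContinuousMap.evalCLM ℝ (p n)).toLinearMap ∘ₗ G.subtype)
  have hL : L ∘ w = fun (t : Ioo (0 : ℝ) 1) (n : ℕ) => (t : ℝ) ^ n := by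
    ext t n
    have heval : (∑' m, φ t m) (p n) = (t : ℝ) ^ n * ‖g n‖⁻¹ * g n (p n) := by
      have h1 := (ContinuousMap.evalCLM ℝ (p n)).map_tsum (hsum t)
      refine h1.trans ((tsum_eq_single n fun m hm => ?_).trans rfl)
      change (t : ℝ) ^ m * ‖g m‖⁻¹ * g m (p n) = 0
      rw [hzero hm, mul_zero]
    change ‖g n‖ * (g n (p n))⁻¹ * (∑' m, φ t m) (p n) = (t : ℝ) ^ n
    rw [heval]
    have := (hnorm n).ne'
    have := hp n
    field_simp
  have hw : LinearIndependent ℝ w :=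
    LinearIndependent.of_comp L (hL ▸ linearIndependent_pow_sequence)
  rw [← Cardinal.mk_Ioo_real (zero_lt_one (α := ℝ))]
  exact hw.cardinal_le_rank

/-- A continuous function is determined by its values on a countable dense set. -/
theorem rank_le_continuum (G : Submodule ℝ C(I, ℝ)) : Module.rank ℝ G ≤ Cardinal.continuum := by
  refine (Submodule.rank_le G).trans ((rank_le_card ℝ _).trans ?_)
  have hinj : Function.Injective fun (f : C(I, ℝ)) (n : ℕ) => f (TopologicalSpace.denseSeq I n) :=
    fun f g hfg => DFunLike.coe_injective
      ((TopologicalSpace.denseRange_denseSeq I).equalizer f.continuous g.continuous hfg)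
  simpa [Cardinal.mk_real] using Cardinal.mk_le_of_injective hinj

theorem exists_Icc_disjoint_finset (s : Finset I) :
    ∃ a b : I, a < b ∧ ∀ x ∈ s, x ∉ Icc a b := by
  have : Infinite I := (Icc_infinite (zero_lt_one (α := ℝ))).to_subtype
  obtain ⟨x, hx⟩ := Infinite.exists_notMem_finset s
  have hnhds : (s : Set I)ᶜ ∈ 𝓝 x := s.finite_toSet.isClosed.isOpen_compl.mem_nhds hx
  obtain ⟨a, b, hxab, hab, hsub⟩ := exists_Icc_mem_subset_of_mem_nhds hnhds
  refine ⟨a, b, (hxab.1.trans hxab.2).lt_of_ne ?_, fun y hy hyab => hsub hyab hy⟩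
  rintro rfl
  rw [Icc_self] at hab
  -- If `a = b`, then `x` would be an isolated point of `[0,1]`.
  have : (𝓝[≠] x).NeBot := inferInstance
  have hxa : x = a := by simpa using hxab
  subst hxa
  exact (not_isOpen_singleton x) (isOpen_singleton_iff_nhds_eq_pure x |>.2
    (le_antisymm (by simpa using hab) (pure_le_nhds x)))

/-- Every finite-dimensional space of functions without nonzero functions of bounded variation lies
in a closed subspace of dimension continuum with the same property. -/
theorem exists_isClosed_ge_of_finiteDimensional (F : Submodule ℝ C(I, ℝ)) [FiniteDimensional ℝ F]
    (hF : ∀ f ∈ F, f ∈ BVC → f = 0) :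
    ∃ G : Submodule ℝ C(I, ℝ), Module.rank ℝ G = Cardinal.continuum ∧ IsClosed (G : Set C(I, ℝ)) ∧
      F ≤ G ∧ ∀ f ∈ G, f ∈ BVC → f = 0 := by
  obtain ⟨s, hs⟩ := exists_finset_forall_locallyBoundedVariationAt_imp_eq_zero F hF
  obtain ⟨a, b, hab, hsab⟩ := exists_Icc_disjoint_finset s
  obtain ⟨c, hc, hcab, -⟩ := exists_seq_strictMono_tendsto' hab
  let J : ℕ → Set I := fun n => Ioo (c n) (c (n + 1))
  let g : ℕ → C(I, ℝ) := fun n => chirpMap (c n) (c (n + 1))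
  have hcn (n : ℕ) : c n < c (n + 1) := hc n.lt_succ_self
  have hJ : Pairwise (Function.onFun Disjoint J) := hc.monotone.pairwise_disjoint_on_Ioo_succ
  have hgJ (n : ℕ) : ∀ x ∉ J n, g n x = 0 := fun x hx => chirp_eq_zero (hcn n) hx
  have hgBV (n : ℕ) : ¬ BoundedVariationOn (g n) (J n) :=
    not_boundedVariationOn_chirpMap (hcn n)
  have hg0 (n : ℕ) : g n ≠ 0 := fun h => hgBV n (h ▸ BoundedVariationOn.of_const 0 (J n))
  have hJsub (n : ℕ) : J n ⊆ Icc a b := fun x hx =>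
    ⟨(hcab n).1.le.trans hx.1.le, hx.2.le.trans (hcab (n + 1)).2.le⟩
  refine ⟨blockSpace g J ⊔ F,
    (rank_le_continuum _).antisymm (continuum_le_rank_of_blockSpace_le hJ hgJ hg0 le_sup_left),
    Submodule.isClosed_sup_finiteDimensional _ _ (isClosed_blockSpace g J), le_sup_right, ?_⟩
  intro h hh hBV
  obtain ⟨w, hw, f, hf, rfl⟩ := Submodule.mem_sup.1 hh
  have hf0 : f = 0 := by
    refine hs f hf fun x hx => ⟨(Icc a b)ᶜ, isClosed_Icc.isOpen_compl, hsab x hx,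
      (BoundedVariationOn.mono hBV (subset_univ _)).congr fun y hy => ?_⟩
    rw [ContinuousMap.add_apply, hw.2 y fun n hn => hy (hJsub n hn), zero_add]
  subst hf0
  rw [add_zero] at hBV ⊢
  exact eq_zero_of_mem_blockSpace_of_mem_BVC hgBV hw hBV

/-! ### Infinite dimension and the main theorem -/

/-- If `V` is an infinite-dimensional space without nonzero functions of bounded variation, then
for each infinite cardinal up to its dimension there is a space of that dimension, without nonzero
functions of bounded variation, whose closure contains the constant function `1`. -/
theorem exists_one_mem_closure {V : Submodule ℝ C(I, ℝ)} (hV : ∀ f ∈ V, f ∈ BVC → f = 0)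
    {α : Cardinal.{0}} (hα : Cardinal.aleph0 ≤ α) (hαV : α ≤ Module.rank ℝ V) :
    ∃ F : Submodule ℝ C(I, ℝ), Module.rank ℝ F = α ∧ (∀ f ∈ F, f ∈ BVC → f = 0) ∧
      (1 : C(I, ℝ)) ∈ closure (F : Set C(I, ℝ)) := by
  obtain ⟨s, hsα, hs⟩ := le_rank_iff_exists_linearIndependent.1 hαV
  have : Infinite s := Cardinal.infinite_iff.2 (hsα ▸ hα)
  let e : ℕ ↪ s := Infinite.natEmbedding s
  let k : s → ℕ := Function.invFun e
  have hk (n : ℕ) : k (e n) = n := Function.leftInverse_invFun e.injective n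
  let v : s → C(I, ℝ) := fun i => ((i : V) : C(I, ℝ))
  have hv : LinearIndependent ℝ v := LinearIndependent.map' hs V.subtype V.ker_subtype
  -- This scaling gives the `n`-th vector of the sequence `e` norm at most `1 / (n + 1)`; off the
  -- range of `e` the value of `k` is immaterial.
  let r : s → ℝˣ := fun i => Units.mk0 (1 / ((k i : ℝ) + 1) * (‖v i‖ + 1)⁻¹) (by positivity)
  have hrv : LinearIndependent ℝ (r • v) := hv.units_smul r
  let u : s → C(I, ℝ) := fun i => (r • v) i + 1
  -- A combination of the `u i` differs from one of the `(r • v) i` by a constant, which has bounded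
  -- variation.
  have hu (l : s →₀ ℝ) (hl : Finsupp.linearCombination ℝ u l ∈ BVC) : l = 0 := by
    have hdecomp : Finsupp.linearCombination ℝ u l =
        Finsupp.linearCombination ℝ (r • v) l + (l.sum fun _ c => c) • (1 : C(I, ℝ)) := by
      simp only [Finsupp.linearCombination_apply, u, smul_add, Finsupp.sum, Finset.sum_add_distrib,
        Finset.sum_smul]
    have hBV : Finsupp.linearCombination ℝ (r • v) l ∈ BVC := by
      have := add_mem_BVC hl (const_smul_one_mem_BVC (-(l.sum fun _ c => c)))
      rwa [hdecomp, add_assoc, ← add_smul, add_neg_cancel, zero_smul, add_zero] at this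
    have hmem : Finsupp.linearCombination ℝ (r • v) l ∈ V := by
      rw [Finsupp.linearCombination_apply]
      exact V.sum_mem fun i _ => V.smul_mem _ (V.smul_mem _ (i : V).2)
    exact linearIndependent_iff.1 hrv l (hV _ hmem hBV)
  have huLI : LinearIndependent ℝ u := linearIndependent_iff.2 fun l hl =>
    hu l (hl ▸ BoundedVariationOn.of_const 0 univ)
  refine ⟨Submodule.span ℝ (range u), ?_, ?_, ?_⟩
  · rw [rank_span huLI, Cardinal.mk_range_eq _ huLI.injective, hsα]
  · intro f hf hBV
    obtain ⟨l, rfl⟩ := (Finsupp.mem_span_range_iff_exists_finsupp).1 hf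
    rw [hu l hBV, Finsupp.sum_zero_index]
  · refine mem_closure_of_tendsto (f := fun n => u (e n)) (b := atTop) ?_
      (Eventually.of_forall fun n => Submodule.subset_span (mem_range_self _))
    have hlim : Tendsto (fun n => (r • v) (e n)) atTop (𝓝 0) := by
      refine squeeze_zero_norm (fun n => ?_) tendsto_one_div_add_atTop_nhds_zero_nat
      change ‖(1 / ((k (e n) : ℝ) + 1) * (‖v (e n)‖ + 1)⁻¹) • v (e n)‖ ≤ _
      rw [hk, norm_smul, Real.norm_of_nonneg (by positivity), mul_assoc]
      refine mul_le_of_le_one_right (by positivity) ?_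
      rw [inv_mul_le_iff₀ (by positivity)]
      linarith
    simpa [u] using hlim.add_const 1

theorem subset_compl_BVC_union_zero_iff {F : Submodule ℝ C(I, ℝ)} :
    (F : Set C(I, ℝ)) ⊆ (univ \ BVC) ∪ {0} ↔ ∀ f ∈ F, f ∈ BVC → f = 0 := by
  refine ⟨fun h f hf hBV => (h hf).resolve_left fun h' => h'.2 hBV, fun h f hf => ?_⟩
  by_cases hBV : f ∈ BVC
  · exact Or.inr (h f hf hBV)
  · exact Or.inl ⟨mem_univ f, hBV⟩

theorem mainTheorem12 (α : Cardinal.{0}) :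
    IsSpaceable ℝ α Cardinal.continuum (Set.univ \ BVC) ↔ α < Cardinal.aleph0 := by
  obtain ⟨V, hVrank, -, -, hV⟩ := exists_isClosed_ge_of_finiteDimensional ⊥
    fun f hf _ => (Submodule.mem_bot ℝ).1 hf
  constructor
  · rintro ⟨⟨E, hE, -⟩, hext⟩
    by_contra! hα
    -- Lineability is what bounds `α` by the continuum, the dimension of `V`.
    obtain ⟨F, hFrank, hF, hF1⟩ :=
      exists_one_mem_closure hV hα (hVrank ▸ hE ▸ rank_le_continuum E)
    obtain ⟨G, -, hGclosed, hFG, hG⟩ := hext F hFrank (subset_compl_BVC_union_zero_iff.2 hF)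
    have h1 : (1 : C(I, ℝ)) ∈ G := closure_minimal hFG hGclosed hF1
    exact one_ne_zero (subset_compl_BVC_union_zero_iff.1 hG 1 h1
      (by simpa using const_smul_one_mem_BVC 1))
  · intro hα
    constructor
    · obtain ⟨s, hsα, hs⟩ := le_rank_iff_exists_linearIndependent.1
        (hVrank ▸ hα.le.trans Cardinal.aleph0_le_continuum : α ≤ Module.rank ℝ V)
      have hv : LinearIndependent ℝ fun i : s => ((i : V) : C(I, ℝ)) :=
        LinearIndependent.map' hs V.subtype V.ker_subtype
      refine ⟨Submodule.span ℝ (range fun i : s => ((i : V) : C(I, ℝ))), ?_, ?_⟩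
      · rw [rank_span hv, Cardinal.mk_range_eq _ hv.injective, hsα]
      · rintro f ⟨hf, hf0⟩
        have hfV : f ∈ V := Submodule.span_le.2 (by rintro _ ⟨i, rfl⟩; exact (i : V).2) hf
        exact ⟨mem_univ f, fun hBV => hf0 (hV f hfV hBV)⟩
    · intro F hFrank hF
      have : FiniteDimensional ℝ F := Module.rank_lt_aleph0_iff.1 (hFrank ▸ hα)
      obtain ⟨G, hGrank, hGclosed, hFG, hG⟩ :=
        exists_isClosed_ge_of_finiteDimensional F (subset_compl_BVC_union_zero_iff.1 hF)
      exact ⟨G, hGrank, hGclosed, hFG, subset_compl_BVC_union_zero_iff.2 hG⟩
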